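/- Let $p$ be a prime. For a commutative ring $A$ of characteristic $p$ let $A^\infty$ denote its perfect closure (obtained by adjoining all $p^e$-th roots of elements of $A$, for all $e \ge 0$). Let $(R,m,K)$ be either (a) a complete Noetherian local domain of characteristic $p$ with maximal ideal $m$ and residue field $K = R/m$; or (b) a standard graded $K$-algebra domain of characteristic $p$, i.e. a domain $R=\bigoplus_{i\ge 0}R_i$ with $R_0=K$ a field of characteristic $p$, generated as a $K$-algebra by finitely many elements of $R_1$, with homogeneous maximal ideal $m=\bigoplus_{i>0}R_i$. Assume that $R$ has Krull dimension $n\ge 2$. Regard $K^\infty$ as an $R^\infty$-module via the ring homomorphism $R^\infty\to K^\infty$ induced by the projection $R\to R/m = K$, and let $E=E_{R^\infty}(K^\infty)$ be an injective hull of $K^\infty$ over $R^\infty$. Then there is an element $e\in E$ that is not killed by any power of $m$, i.e. $m^t e\neq 0$ for every $t\ge 0$. -/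

import Mathlib

universe u v w

/-- `ι : N → E` is an injective hull of the `S`-module `N`: the module `E` is injective and `ι`
is an essential extension (an injection whose image meets every nonzero submodule of `E`). -/
structure IsInjectiveHull {S : Type u} [CommRing S] {N : Type w} [AddCommGroup N] [Module S N]
    {E : Type v} [AddCommGroup E] [Module S E] (ι : N →ₗ[S] E) : Prop where
  injective_map : Function.Injective ι
  essential : ∀ P : Submodule S E, P ⊓ LinearMap.range ι = ⊥ → P = ⊥
  injective_module : Module.Injective S E

/-- The ring homomorphism `R^∞ → K^∞` of perfect closures induced by `ε : R → K`. -/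
noncomputable def perfectClosureMap {R : Type u} {K : Type w} [CommRing R] [CommRing K]
    (p : ℕ) [Fact p.Prime] [CharP R p] [CharP K p] (ε : R →+* K) :
    PerfectClosure R p →+* PerfectClosure K p :=
  PerfectClosure.lift R p (PerfectClosure K p) ((PerfectClosure.of K p).comp ε)

/-- `K^∞`, regarded as an `R^∞`-module through the map induced by `ε : R → K`. -/
def PerfectResidue {R : Type u} {K : Type w} [CommRing R] [CommRing K]
    (p : ℕ) [Fact p.Prime] [CharP R p] [CharP K p] (_ε : R →+* K) : Type w :=
  PerfectClosure K p

noncomputable instance {R : Type u} {K : Type w} [CommRing R] [CommRing K]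
    (p : ℕ) [Fact p.Prime] [CharP R p] [CharP K p] (ε : R →+* K) :
    AddCommGroup (PerfectResidue p ε) :=
  inferInstanceAs (AddCommGroup (PerfectClosure K p))

noncomputable instance {R : Type u} {K : Type w} [CommRing R] [CommRing K]
    (p : ℕ) [Fact p.Prime] [CharP R p] [CharP K p] (ε : R →+* K) :
    Module (PerfectClosure R p) (PerfectResidue p ε) :=
  Module.compHom (PerfectClosure K p) (perfectClosureMap p ε)

instance charP_residueField (R : Type u) [CommRing R] [IsLocalRing R] (p : ℕ) [Fact p.Prime]
    [CharP R p] : CharP (IsLocalRing.ResidueField R) p :=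
  (CharP.charP_iff_prime_eq_zero Fact.out).2 <| by
    rw [← map_natCast (IsLocalRing.residue R), CharP.cast_eq_zero, map_zero]

/-- `R = ⨁ 𝒜 i` is a standard graded `K`-algebra: `R₀ = K`, and `R` is generated as a
`K`-algebra by finitely many elements of degree one. -/
structure IsStandardGraded {K : Type w} {R : Type u} [Field K] [CommRing R] [Algebra K R]
    (𝒜 : ℕ → Submodule K R) [GradedAlgebra 𝒜] : Prop where
  bijective_zero : Function.Bijective (algebraMap K (𝒜 0))
  generated : ∃ s : Finset R, (s : Set R) ⊆ (𝒜 1 : Set R) ∧ Algebra.adjoin K (s : Set R) = ⊤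

/-- The projection `R → R₀ = K` of a standard graded `K`-algebra onto its degree-zero part; its
kernel is the homogeneous maximal ideal. -/
noncomputable def IsStandardGraded.augmentation {K : Type w} {R : Type u} [Field K] [CommRing R]
    [Algebra K R] {𝒜 : ℕ → Submodule K R} [GradedAlgebra 𝒜] (h : IsStandardGraded 𝒜) : R →+* K :=
  ((RingEquiv.ofBijective (algebraMap K (𝒜 0)) h.bijective_zero).symm : 𝒜 0 →+* K).comp
    (GradedRing.projZeroRingHom' 𝒜)

/-! Write S = R^∞, let n be the kernel of S → K^∞, and put g_t = x^t y^(1/p^t) for suitable x, y ∈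
m. Each g_t lies in m^t S. If every relation among the g_t has all its coefficients in n, then all
the g_t can be identified modulo an ideal J in such a way that g_0 spans a copy of S/n inside S/J
(`exists_ideal_identifying`). Injectivity of E then yields e ∈ E with J e = 0 and g_0 e = ι(1) ≠ 0.
Since g_t e = g_0 e for all t, no power of m kills e.

Suppose a relation has its coefficient c_t outside n. Then c_t x^t y^(1/p^t) ∈ (x^(t+1),
y^(1/p^(t-1))). High Frobenius powers bring this into R, and localizing at a minimal prime of (x, y)
makes the coefficient a unit. The resulting monomial relations hold for all large q = p^e and force
the length of T/(x^q, y^q) to grow more slowly than q². This contradicts the lower bound q² of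
`mul_le_pairLength`; see `exists_monomial_notMem`.

Both cases need only that m has height at least 2. In the graded case this is
`IsStandardGraded.two_le_height`. -/

/-! ### Upper bounds for the length of T/(x^k, y^l). -/

/-- If `C * a ⊆ I`, then `T ⧸ I` is an extension of `T ⧸ (I + (a))` by a quotient of `T ⧸ C`. -/
theorem length_quotient_le_add {T : Type*} [CommRing T] {I C D : Ideal T} (a : T)
    (hC : ∀ c ∈ C, c * a ∈ I) (hD : D ≤ I ⊔ Ideal.span {a}) :
    Module.length T (T ⧸ I) ≤ Module.length T (T ⧸ D) + Module.length T (T ⧸ C) := by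
  let f : (T ⧸ C) →ₗ[T] (T ⧸ I) :=
    Submodule.liftQ C (LinearMap.toSpanSingleton T (T ⧸ I) (Submodule.Quotient.mk a)) fun c hc => by
      rw [LinearMap.mem_ker, LinearMap.toSpanSingleton_apply, ← Submodule.Quotient.mk_smul,
        Submodule.Quotient.mk_eq_zero]
      exact hC c hc
  let g : (T ⧸ D) →ₗ[T] ((T ⧸ I) ⧸ LinearMap.range f) :=
    Submodule.liftQ D ((LinearMap.range f).mkQ ∘ₗ I.mkQ) fun d hd => by
      obtain ⟨i, hi, z, hz, rfl⟩ := Submodule.mem_sup.1 (hD hd)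
      obtain ⟨c, rfl⟩ := Ideal.mem_span_singleton'.1 hz
      rw [LinearMap.mem_ker, LinearMap.comp_apply, Submodule.mkQ_apply, Submodule.mkQ_apply,
        Submodule.Quotient.mk_eq_zero]
      refine ⟨Submodule.Quotient.mk c, ?_⟩
      simp only [f, Submodule.liftQ_apply, LinearMap.toSpanSingleton_apply]
      rw [← Submodule.Quotient.mk_smul, Submodule.Quotient.eq]
      simpa using hi
  have hg : Function.Surjective g := by
    intro z
    obtain ⟨z, rfl⟩ := Submodule.Quotient.mk_surjective _ z
    obtain ⟨z, rfl⟩ := Submodule.Quotient.mk_surjective _ z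
    exact ⟨Submodule.Quotient.mk z, rfl⟩
  rw [Module.length_eq_add_of_exact (LinearMap.range f).subtype (LinearMap.range f).mkQ
    (Submodule.subtype_injective _) (Submodule.mkQ_surjective _)
    (LinearMap.exact_subtype_mkQ _), add_comm]
  exact add_le_add (Module.length_le_of_surjective g hg)
    (Module.length_le_of_surjective f.rangeRestrict f.surjective_rangeRestrict)

/-- The length of `T ⧸ (x, y)`. -/
noncomputable def pairLength {T : Type*} [CommRing T] (x y : T) : ℕ∞ :=
  Module.length T (T ⧸ Ideal.span {x, y})

theorem pairLength_comm {T : Type*} [CommRing T] (x y : T) : pairLength x y = pairLength y x := by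
  rw [pairLength, pairLength, Set.pair_comm]

theorem pairLength_pow_left_le {T : Type*} [CommRing T] (x y : T) (k : ℕ) :
    pairLength (x ^ k) y ≤ k * pairLength x y := by
  induction k with
  | zero =>
    have : Ideal.span {x ^ 0, y} = (⊤ : Ideal T) :=
      (Ideal.eq_top_iff_one _).2 (Ideal.subset_span (by simp))
    have : Subsingleton (T ⧸ Ideal.span {x ^ 0, y}) := Submodule.Quotient.subsingleton_iff.2 this
    simp [pairLength]
  | succ k ih =>
    refine (length_quotient_le_add (C := Ideal.span {x, y}) (D := Ideal.span {x ^ k, y}) (x ^ k)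
      ?_ ?_).trans ?_
    · intro c hc
      obtain ⟨a, b, rfl⟩ := Ideal.mem_span_pair.1 hc
      exact Ideal.mem_span_pair.2 ⟨a, b * x ^ k, by ring⟩
    · rw [Ideal.span_le]
      rintro z (rfl | rfl)
      · exact Ideal.mem_sup_right (Ideal.mem_span_singleton_self _)
      · exact Ideal.mem_sup_left (Ideal.subset_span (by simp))
    · push_cast
      rw [add_mul, one_mul]
      exact add_le_add ih le_rfl

theorem pairLength_pow_pow_le {T : Type*} [CommRing T] (x y : T) (k l : ℕ) :
    pairLength (x ^ k) (y ^ l) ≤ (k * l : ℕ) * pairLength x y := by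
  refine (pairLength_pow_left_le x (y ^ l) k).trans ?_
  rw [pairLength_comm x]
  refine (mul_le_mul_right (pairLength_pow_left_le y x l) _).trans ?_
  rw [pairLength_comm y x, ← mul_assoc, Nat.cast_mul]

/-- A monomial relation `x ^ a * y ∈ (x ^ (a + 1), y ^ (b + 1))` makes the length of
`T ⧸ (x ^ (a + 1), y ^ (b + 1))` smaller than expected. -/
theorem pairLength_le_of_mem {T : Type*} [CommRing T] (x y : T) (a b : ℕ)
    (h : x ^ a * y ∈ Ideal.span {x ^ (a + 1), y ^ (b + 1)}) :
    pairLength (x ^ (a + 1)) (y ^ (b + 1)) ≤ (a + 1 + a * b : ℕ) * pairLength x y := by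
  refine (length_quotient_le_add (C := Ideal.span {x ^ a, y ^ b})
    (D := Ideal.span {x ^ (a + 1), y}) y ?_ ?_).trans ?_
  · intro c hc
    obtain ⟨s, t, rfl⟩ := Ideal.mem_span_pair.1 hc
    have : (s * x ^ a + t * y ^ b) * y = s * (x ^ a * y) + t * y ^ (b + 1) := by ring
    rw [this]
    exact add_mem (Ideal.mul_mem_left _ _ h) (Ideal.mul_mem_left _ _ (Ideal.subset_span (by simp)))
  · rw [Ideal.span_le]
    rintro z (rfl | rfl)
    · exact Ideal.mem_sup_left (Ideal.subset_span (by simp))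
    · exact Ideal.mem_sup_right (Ideal.mem_span_singleton_self _)
  · rw [Nat.cast_add, add_mul]
    exact add_le_add (pairLength_pow_left_le x y (a + 1)) (pairLength_pow_pow_le x y a b)

/-! ### Lower bounds for the length of T/(x^k, y^l). -/

/-- Lower bound for the length of `T ⧸ (J l + (x ^ k))` along a strictly decreasing chain of
ideals modulo which `x` is a nonzerodivisor. -/
theorem mul_le_length_quotient_sup {T : Type*} [CommRing T] [IsLocalRing T] [IsNoetherianRing T]
    {x : T} (hx : x ∈ IsLocalRing.maximalIdeal T) (J : ℕ → Ideal T)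
    (hJ : ∀ i, J (i + 1) < J i) (hreg : ∀ i a, x * a ∈ J i → a ∈ J i) (k l : ℕ) :
    ((l * k : ℕ) : ℕ∞) ≤ Order.coheight (J l ⊔ Ideal.span {x ^ k}) := by
  have hregpow : ∀ j i a, x ^ j * a ∈ J i → a ∈ J i := by
    intro j
    induction j with
    | zero => intro i a h; simpa using h
    | succ j ih => intro i a h; exact hreg i a (ih i _ (by rwa [pow_succ, mul_assoc] at h))
  have hmem : ∀ i j z, z ∈ J (i + 1) ⊔ Ideal.span {x ^ j} * J i ⊔ Ideal.span {x ^ k} ↔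
      ∃ b ∈ J (i + 1), ∃ c ∈ J i, ∃ r, z = b + x ^ j * c + x ^ k * r := by
    intro i j z
    simp only [Submodule.mem_sup, Ideal.mem_span_singleton_mul, Ideal.mem_span_singleton']
    constructor
    · rintro ⟨_, ⟨b, hb, _, ⟨c, hc, rfl⟩, rfl⟩, _, ⟨r, rfl⟩, rfl⟩
      exact ⟨b, hb, c, hc, r, by ring⟩
    · rintro ⟨b, hb, c, hc, r, rfl⟩
      exact ⟨_, ⟨b, hb, _, ⟨c, hc, rfl⟩, rfl⟩, _, ⟨r, rfl⟩, by ring⟩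
  have hstrict : ∀ i j, j < k →
      J (i + 1) ⊔ Ideal.span {x ^ (j + 1)} * J i ⊔ Ideal.span {x ^ k} <
        J (i + 1) ⊔ Ideal.span {x ^ j} * J i ⊔ Ideal.span {x ^ k} := by
    intro i j hj
    refine lt_of_le_of_ne ?_ fun heq => ?_
    · intro z hz
      obtain ⟨b, hb, c, hc, r, rfl⟩ := (hmem _ _ _).1 hz
      exact (hmem _ _ _).2 ⟨b, hb, x * c, Ideal.mul_mem_left _ _ hc, r, by ring⟩
    -- Equality would give J_i ⊆ J_(i+1) + x J_i after cancelling x^j, hence J_i ⊆ J_(i+1) by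
    -- Nakayama.
    · refine (hJ i).not_ge ?_
      refine Submodule.le_of_le_smul_of_le_jacobson_bot (I := Ideal.span {x})
        (IsNoetherian.noetherian _) ?_ ?_
      · rw [IsLocalRing.jacobson_eq_maximalIdeal _ bot_ne_top, Ideal.span_singleton_le_iff_mem]
        exact hx
      · intro a ha
        have : x ^ j * a ∈ J (i + 1) ⊔ Ideal.span {x ^ (j + 1)} * J i ⊔ Ideal.span {x ^ k} := by
          rw [heq]
          exact (hmem _ _ _).2 ⟨0, zero_mem _, a, ha, 0, by ring⟩
        obtain ⟨b, hb, c, hc, r, hr⟩ := (hmem _ _ _).1 this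
        have hr' : r ∈ J i := by
          refine hregpow k i r ?_
          have : x ^ k * r = x ^ j * a - b - x ^ (j + 1) * c := by rw [hr]; ring
          rw [this]
          exact sub_mem (sub_mem (Ideal.mul_mem_left _ _ ha) ((hJ i).le hb))
            (Ideal.mul_mem_left _ _ hc)
        obtain ⟨d, rfl⟩ := Nat.exists_eq_add_of_lt hj
        have hmemJ : a - x * (c + x ^ d * r) ∈ J (i + 1) := by
          refine hregpow j _ _ ?_
          have : x ^ j * (a - x * (c + x ^ d * r)) = b := by
            rw [mul_sub, hr]; ring
          rwa [this]
        refine Submodule.mem_sup.2 ⟨_, hmemJ, x * (c + x ^ d * r), ?_, by ring⟩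
        exact Ideal.mul_mem_mul (Ideal.mem_span_singleton_self x)
          (add_mem hc (Ideal.mul_mem_left _ _ hr'))
  induction l with
  | zero => simp
  | succ l ih =>
    -- The ideals J_(l+1) + x^j J_l + (x^k), for j = 0, ..., k, descend from J_l + (x^k) to J_(l+1)
    -- + (x^k) in k strict steps.
    have hstep : ∀ j ≤ k, ((l * k + j : ℕ) : ℕ∞) ≤
        Order.coheight (J (l + 1) ⊔ Ideal.span {x ^ j} * J l ⊔ Ideal.span {x ^ k}) := by
      intro j
      induction j with
      | zero =>
        intro _
        simpa [(hJ l).le] using ih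
      | succ j ihj =>
        intro hj
        refine le_trans ?_ (Order.coheight_add_one_le (hstrict l j hj))
        rw [← add_assoc, Nat.cast_add_one]
        exact add_le_add (ihj (by omega)) le_rfl
    refine le_trans (by rw [add_mul, one_mul]) ((hstep k le_rfl).trans ?_)
    refine Order.coheight_anti (sup_le_sup_right le_sup_left _)

/-- The chain is J_i = y^i T_Q ∩ T. It decreases strictly because y ∈ Q is not a unit in T_Q, and x
is a nonzerodivisor modulo J_i because x becomes a unit there. No Cohen–Macaulay hypothesis is
needed. -/
theorem mul_le_pairLength {T : Type*} [CommRing T] [IsDomain T] [IsLocalRing T]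
    [IsNoetherianRing T] {x y : T} (hx : x ∈ IsLocalRing.maximalIdeal T) (hy : y ≠ 0)
    (Q : Ideal T) [Q.IsPrime] (hyQ : y ∈ Q) (hxQ : x ∉ Q) (k l : ℕ) :
    ((l * k : ℕ) : ℕ∞) ≤ pairLength (x ^ k) (y ^ l) := by
  let J : ℕ → Ideal T := fun i =>
    ((Ideal.span {y ^ i}).map (algebraMap T (Localization.AtPrime Q))).comap
      (algebraMap T (Localization.AtPrime Q))
  have hJ : ∀ i z, z ∈ J i ↔ ∃ s ∉ Q, s * z ∈ Ideal.span {y ^ i} := by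
    intro i z
    rw [Ideal.mem_comap, IsLocalization.algebraMap_mem_map_algebraMap_iff Q.primeCompl]
    rfl
  have hle := mul_le_length_quotient_sup hx J ?_ ?_ k l
  · refine hle.trans ?_
    rw [pairLength, Module.length_quotient]
    refine Order.coheight_anti ?_
    rw [Ideal.span_le]
    rintro z (rfl | rfl)
    · exact Ideal.mem_sup_right (Ideal.mem_span_singleton_self _)
    · exact Ideal.mem_sup_left ((hJ _ _).2 ⟨1, (Ideal.ne_top_iff_one Q).1 ‹Q.IsPrime›.ne_top,
        by rw [one_mul]; exact Ideal.mem_span_singleton_self _⟩)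
  · intro i
    refine lt_of_le_of_ne ?_ fun heq => ?_
    · refine Ideal.comap_mono (Ideal.map_mono ?_)
      rw [Ideal.span_singleton_le_span_singleton]
      exact pow_dvd_pow _ (Nat.le_succ i)
    · have : y ^ i ∈ J (i + 1) := by
        rw [heq]
        exact Ideal.mem_comap.2 (Ideal.mem_map_of_mem _ (Ideal.mem_span_singleton_self _))
      obtain ⟨s, hs, hsy⟩ := (hJ _ _).1 this
      obtain ⟨c, hc⟩ := Ideal.mem_span_singleton'.1 hsy
      refine hs ?_
      have : s = c * y := mul_right_cancel₀ (pow_ne_zero i hy) (by rw [← hc]; ring)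
      rw [this]
      exact Ideal.mul_mem_left _ _ hyQ
  · intro i a ha
    obtain ⟨s, hs, hsa⟩ := (hJ _ _).1 ha
    refine (hJ _ _).2 ⟨s * x, fun h => ?_, by rwa [mul_assoc]⟩
    exact (‹Q.IsPrime›.mem_or_mem h).elim hs hxQ

theorem pairLength_ne_top {T : Type*} [CommRing T] [IsLocalRing T] [IsNoetherianRing T] {x y : T}
    (hx : x ∈ IsLocalRing.maximalIdeal T) (hy : y ∈ IsLocalRing.maximalIdeal T)
    (h : IsLocalRing.maximalIdeal T ≤ (Ideal.span {x, y}).radical) : pairLength x y ≠ ⊤ := by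
  have hle : Ideal.span {x, y} ≤ IsLocalRing.maximalIdeal T := by
    rw [Ideal.span_le]
    rintro z (rfl | rfl)
    exacts [hx, hy]
  obtain ⟨N, hN⟩ := Ideal.exists_pow_le_of_le_radical_of_fg h (IsNoetherian.noetherian _)
  have : Nontrivial (T ⧸ Ideal.span {x, y}) :=
    Ideal.Quotient.nontrivial_iff.2 fun h =>
      (IsLocalRing.maximalIdeal.isMaximal T).ne_top (top_le_iff.1 (h ▸ hle))
  have : IsLocalRing (T ⧸ Ideal.span {x, y}) :=
    IsLocalRing.of_surjective' (Ideal.Quotient.mk _) Ideal.Quotient.mk_surjective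
  have : IsArtinianRing (T ⧸ Ideal.span {x, y}) := by
    rw [isArtinianRing_iff_isNilpotent_maximalIdeal]
    refine ⟨N, ?_⟩
    rw [← IsLocalRing.map_maximalIdeal_of_surjective (Ideal.Quotient.mk (Ideal.span {x, y}))
      Ideal.Quotient.mk_surjective, ← Ideal.map_pow, Ideal.zero_eq_bot,
      Ideal.map_eq_bot_iff_le_ker, Ideal.mk_ker]
    exact hN
  rw [pairLength, Module.length_eq_of_surjective (R := T ⧸ Ideal.span {x, y})
    Ideal.Quotient.mk_surjective]
  exact Module.length_ne_top

/-! ### Monomial relations contradict quadratic growth of length. -/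

/-- In a Noetherian local domain with parameters `x`, `y`, the monomial relations
`x ^ (a q) * y ^ q ∈ (x ^ ((a + 1) q), y ^ (p q))` cannot hold for all large powers `q` of `p`. -/
theorem exists_monomial_notMem {T : Type*} [CommRing T] [IsDomain T] [IsLocalRing T]
    [IsNoetherianRing T] {x y : T} (hx : x ∈ IsLocalRing.maximalIdeal T) (hy : y ≠ 0)
    (Q : Ideal T) [Q.IsPrime] (hyQ : y ∈ Q) (hxQ : x ∉ Q)
    (h : IsLocalRing.maximalIdeal T ≤ (Ideal.span {x, y}).radical)
    {p : ℕ} (hp : 2 ≤ p) (a e₀ : ℕ) :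
    ∃ e, e₀ ≤ e ∧ x ^ (a * p ^ e) * y ^ p ^ e ∉
      Ideal.span {x ^ ((a + 1) * p ^ e), y ^ (p * p ^ e)} := by
  by_contra! hcon
  -- Multiplying the relation by x^(dq), where p^(f+1) = a + 1 + d, turns the exponent of x^q into a
  -- power of p, so that the estimate can be iterated.
  obtain ⟨f, hf⟩ : ∃ f, a + 1 ≤ p ^ (f + 1) :=
    ⟨a, (Nat.lt_pow_self (by omega)).le⟩
  obtain ⟨d, hd⟩ := Nat.exists_eq_add_of_le hf
  -- The second factor comes from `pairLength_le_of_mem`, and p^f from raising y^(pq) to y^(p^(f+1)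
  -- q). The expected constant p^(2(f+1)) exceeds C by p^f (p - 1).
  obtain ⟨C, hCdef⟩ : ∃ C, C = p ^ f * (a + d + 1 + (a + d) * (p - 1)) := ⟨_, rfl⟩
  have hpf : p ^ (f + 1) = a + d + 1 := by rw [hd]; ring
  have hC : C < p ^ (2 * (f + 1)) := by
    have : p ^ (2 * (f + 1)) = p ^ f * ((a + d + 1) * p) := by rw [← hpf]; ring
    rw [hCdef, this]
    refine Nat.mul_lt_mul_of_pos_left ?_ (by positivity)
    obtain ⟨r, rfl⟩ := Nat.exists_eq_add_of_le hp
    have : 2 + r - 1 = r + 1 := by omega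
    rw [this]
    nlinarith
  have hstep : ∀ e, e₀ ≤ e → pairLength (x ^ p ^ (e + (f + 1))) (y ^ p ^ (e + (f + 1))) ≤
      C * pairLength (x ^ p ^ e) (y ^ p ^ e) := by
    intro e he
    have h1 : p - 1 + 1 = p := by omega
    have hrel : (x ^ p ^ e) ^ (a + d) * y ^ p ^ e ∈
        Ideal.span {(x ^ p ^ e) ^ (a + d + 1), (y ^ p ^ e) ^ (p - 1 + 1)} := by
      obtain ⟨s, t, hst⟩ := Ideal.mem_span_pair.1 (hcon e he)
      refine Ideal.mem_span_pair.2 ⟨s, t * (x ^ p ^ e) ^ d, ?_⟩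
      have h2 : (x ^ p ^ e) ^ (a + d) * y ^ p ^ e =
          (x ^ p ^ e) ^ d * (x ^ (a * p ^ e) * y ^ p ^ e) := by ring
      rw [h1, h2, ← hst]
      ring
    have hx' : x ^ p ^ (e + (f + 1)) = (x ^ p ^ e) ^ (a + d + 1) := by
      rw [← hpf, ← pow_mul, ← pow_add]
    have hy' : y ^ p ^ (e + (f + 1)) = ((y ^ p ^ e) ^ (p - 1 + 1)) ^ p ^ f := by
      rw [h1, ← pow_mul, ← pow_mul]
      ring_nf
    rw [hx', hy', pairLength_comm]
    refine (pairLength_pow_left_le _ _ _).trans ?_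
    rw [pairLength_comm, hCdef, Nat.cast_mul, mul_assoc]
    exact mul_le_mul_right (pairLength_le_of_mem _ _ _ _ hrel) _
  have hiter : ∀ j, pairLength (x ^ p ^ (e₀ + j * (f + 1))) (y ^ p ^ (e₀ + j * (f + 1))) ≤
      (C ^ j : ℕ) * pairLength (x ^ p ^ e₀) (y ^ p ^ e₀) := by
    intro j
    induction j with
    | zero => simp
    | succ j ih =>
      have := hstep (e₀ + j * (f + 1)) (by omega)
      rw [add_mul, one_mul, ← add_assoc]
      refine this.trans ((mul_le_mul_right ih _).trans ?_)
      rw [← mul_assoc, pow_succ, Nat.cast_mul, mul_comm (C : ℕ∞)]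
  have hfin : pairLength (x ^ p ^ e₀) (y ^ p ^ e₀) ≠ ⊤ := by
    refine ne_top_of_le_ne_top ?_ (pairLength_pow_pow_le x y (p ^ e₀) (p ^ e₀))
    exact WithTop.mul_ne_top (ENat.natCast_ne_top _)
      (pairLength_ne_top hx (IsLocalRing.le_maximalIdeal ‹Q.IsPrime›.ne_top hyQ) h)
  obtain ⟨M, hM⟩ := ENat.ne_top_iff_exists.1 hfin
  have hbound : ∀ j, (p ^ (2 * (f + 1))) ^ j ≤ C ^ j * M := by
    intro j
    have := (mul_le_pairLength hx hy Q hyQ hxQ (p ^ (e₀ + j * (f + 1)))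
      (p ^ (e₀ + j * (f + 1)))).trans (hiter j)
    rw [← hM] at this
    norm_cast at this
    refine le_trans ?_ this
    rw [← pow_mul, ← pow_add]
    exact Nat.pow_le_pow_right (by omega) (by nlinarith)
  have hB : (0 : ℝ) < (p : ℝ) ^ (2 * (f + 1)) := by positivity
  obtain ⟨j, hj⟩ := exists_pow_lt_of_lt_one (show (0 : ℝ) < 1 / (M + 1) by positivity)
    (show (C : ℝ) / (p : ℝ) ^ (2 * (f + 1)) < 1 by
      rw [div_lt_one hB]; exact_mod_cast hC)
  rw [div_pow, div_lt_div_iff₀ (by positivity) (by positivity), one_mul] at hj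
  have hj' : C ^ j * (M + 1) < (p ^ (2 * (f + 1))) ^ j := by exact_mod_cast hj
  have := hbound j
  rw [mul_add] at hj'
  omega

/-- By Krull's height theorem m lies in no minimal prime of (y), so prime avoidance gives x ∈ m
outside all of them. -/
theorem exists_parameters_of_two_le_height {R : Type*} [CommRing R] [IsDomain R]
    [IsNoetherianRing R] (m : Ideal R) [m.IsPrime] (hm : 2 ≤ m.height) :
    ∃ x y : R, ∃ P Q : Ideal R, P.IsPrime ∧ Q.IsPrime ∧ P ∈ (Ideal.span {x, y}).minimalPrimes ∧
      P ≤ m ∧ Q ≤ P ∧ y ≠ 0 ∧ y ∈ Q ∧ x ∉ Q := by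
  have hbot : m ≠ ⊥ := by
    rintro rfl
    simp at hm
  obtain ⟨y, hym, hy0⟩ := Submodule.exists_mem_ne_zero_of_ne_bot hbot
  obtain ⟨x, hxm, hx⟩ : ∃ x ∈ m, ∀ Q ∈ (Ideal.span {y}).minimalPrimes, x ∉ Q := by
    by_contra! hcon
    have hfin := Ideal.finite_minimalPrimes_of_isNoetherianRing R (Ideal.span {y})
    obtain ⟨Q, hQ, hmQ⟩ := (Ideal.subset_union_prime_finite (f := fun Q : Ideal R => Q) (I := m)
      hfin ⊥ ⊥ (fun Q hQ _ _ => hQ.1.1)).1 (fun x hx => by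
        obtain ⟨Q, hQ, hxQ⟩ := hcon x hx
        exact Set.mem_biUnion hQ hxQ)
    have h1 := Ideal.height_le_one_of_isPrincipal_of_mem_minimalPrimes (Ideal.span {y}) Q hQ
    have h2 := hm.trans ((Ideal.height_mono hmQ).trans h1)
    exact absurd h2 (by decide)
  obtain ⟨P, hP, hPm⟩ := Ideal.exists_minimalPrimes_le (I := Ideal.span {x, y}) (J := m) (by
    rw [Ideal.span_le]
    rintro z (rfl | rfl)
    exacts [hxm, hym])
  have := hP.1.1
  have hyP : y ∈ P := hP.1.2 (Ideal.subset_span (by simp))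
  obtain ⟨Q, hQ, hQP⟩ := Ideal.exists_minimalPrimes_le (I := Ideal.span {y}) (J := P) (by
    rwa [Ideal.span_singleton_le_iff_mem])
  exact ⟨x, y, P, Q, hP.1.1, hQ.1.1, hP, hPm, hQP, hy0,
    hQ.1.2 (Ideal.mem_span_singleton_self y), hx Q hQ⟩

/-- In the localization at P, d becomes a unit and x^N, y still generate the maximal ideal up to
radical. -/
theorem exists_mul_monomial_notMem {R : Type*} [CommRing R] [IsDomain R] [IsNoetherianRing R]
    {x y : R} {P Q : Ideal R} [P.IsPrime] [Q.IsPrime]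
    (hP : P ∈ (Ideal.span {x, y}).minimalPrimes) (hQP : Q ≤ P) (hy : y ≠ 0) (hyQ : y ∈ Q)
    (hxQ : x ∉ Q) {p : ℕ} (hp : 2 ≤ p) {N : ℕ} (hN : N ≠ 0) (a e₀ : ℕ) :
    ∃ e, e₀ ≤ e ∧ ∀ d ∉ P, d * ((x ^ N) ^ (a * p ^ e) * y ^ p ^ e) ∉
      Ideal.span {(x ^ N) ^ ((a + 1) * p ^ e), y ^ (p * p ^ e)} := by
  let T := Localization.AtPrime P
  let f : R →+* T := algebraMap R T
  have hxP : x ∈ P := hP.1.2 (Ideal.subset_span (by simp))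
  have hdisj : Disjoint (P.primeCompl : Set R) Q :=
    Set.disjoint_left.2 fun z hz hzQ => hz (hQP hzQ)
  have hQT : (Q.map f).IsPrime :=
    IsLocalization.isPrime_of_isPrime_disjoint P.primeCompl T Q inferInstance hdisj
  have hcomap : (Q.map f).comap f = Q :=
    IsLocalization.under_map_of_isPrime_disjoint P.primeCompl T inferInstance hdisj
  have hfinj : Function.Injective f :=
    IsLocalization.injective T P.primeCompl_le_nonZeroDivisors
  have hrad : IsLocalRing.maximalIdeal T ≤ (Ideal.span {f (x ^ N), f y}).radical := by
    have h1 : IsLocalRing.maximalIdeal T = (Ideal.span {f x, f y}).radical := by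
      rw [← Localization.AtPrime.map_eq_maximalIdeal,
        ← IsLocalization.AtPrime.radical_map_of_mem_minimalPrimes T P _ hP,
        Ideal.map_span, Set.image_pair]
    rw [h1, Ideal.radical_le_radical_iff, Ideal.span_le]
    rintro z (rfl | rfl)
    · exact ⟨N, Ideal.subset_span (by simp)⟩
    · exact Ideal.le_radical (Ideal.subset_span (by simp))
  obtain ⟨e, he, hne⟩ := exists_monomial_notMem (x := f (x ^ N)) (y := f y)
    (by
      rw [map_pow]
      exact Ideal.pow_mem_of_mem _ ((IsLocalization.AtPrime.to_map_mem_maximal_iff T P x).2 hxP) N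
        (Nat.pos_of_ne_zero hN))
    (by rwa [Ne, map_eq_zero_iff f hfinj]) (Q.map f) (Ideal.mem_map_of_mem f hyQ)
    (fun h => hxQ (by
      have : x ^ N ∈ (Q.map f).comap f := h
      rw [hcomap] at this
      exact ‹Q.IsPrime›.mem_of_pow_mem N this)) hrad hp a e₀
  refine ⟨e, he, fun d hd hmem => hne ?_⟩
  have hunit : IsUnit (f d) := IsLocalization.map_units T (⟨d, hd⟩ : P.primeCompl)
  rw [← Ideal.unit_mul_mem_iff_mem _ hunit]
  obtain ⟨s, t, hst⟩ := Ideal.mem_span_pair.1 hmem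
  refine Ideal.mem_span_pair.2 ⟨f s, f t, ?_⟩
  simp only [← map_pow, ← map_mul, ← map_add]
  exact congrArg f hst

/-! ### Perfect closures. -/

section PerfectClosure

variable {R : Type u} {K : Type w} [CommRing R] [CommRing K] (p : ℕ) [Fact p.Prime] [CharP R p]
  [CharP K p]

theorem PerfectClosure.mk_pow_pow (n : ℕ) (r : R) :
    PerfectClosure.mk R p (n, r) ^ p ^ n = PerfectClosure.of R p r := by
  rw [← PerfectClosure.iterate_frobenius_mk, iterate_frobenius]

theorem PerfectClosure.eventually_pow_mem_range (s : PerfectClosure R p) :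
    ∃ e₀, ∀ e, e₀ ≤ e → ∃ r, s ^ p ^ e = PerfectClosure.of R p r := by
  obtain ⟨⟨n, r⟩, rfl⟩ := PerfectClosure.mk_surjective R p s
  refine ⟨n, fun e he => ?_⟩
  obtain ⟨d, rfl⟩ := Nat.exists_eq_add_of_le he
  exact ⟨r ^ p ^ d, by rw [pow_add, pow_mul, PerfectClosure.mk_pow_pow, map_pow]⟩

theorem PerfectClosure.of_injective [IsReduced R] :
    Function.Injective (PerfectClosure.of R p) := by
  intro a b h
  simpa using (PerfectClosure.eq_iff R p (0, a) (0, b)).1 h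

theorem perfectClosureMap_of (ε : R →+* K) (r : R) :
    perfectClosureMap p ε (PerfectClosure.of R p r) = PerfectClosure.of K p (ε r) :=
  RingHom.congr_fun ((PerfectClosure.lift R p (PerfectClosure K p)).symm_apply_apply
    ((PerfectClosure.of K p).comp ε)) r

theorem perfectClosureMap_surjective {ε : R →+* K} (hε : Function.Surjective ε) :
    Function.Surjective (perfectClosureMap p ε) := by
  intro b
  obtain ⟨⟨n, k⟩, rfl⟩ := PerfectClosure.mk_surjective K p b
  obtain ⟨r, rfl⟩ := hε k
  refine ⟨PerfectClosure.mk R p (n, r), (bijective_iterateFrobenius (PerfectClosure K p) p n).1 ?_⟩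
  simp only [iterateFrobenius_def]
  rw [← map_pow, PerfectClosure.mk_pow_pow, PerfectClosure.mk_pow_pow, perfectClosureMap_of]

end PerfectClosure

/-! ### Socle elements and injective modules. -/

/-- Let `n` be a maximal ideal of `S` and `z` an element of an injective module `E` killed by `n`.
If `a ∈ S` represents a nonzero element of `S ⧸ J` killed by `n`, then some element of `E` is killed
by `J` and carried to `z` by `a`. -/
theorem Module.Injective.exists_smul_eq {S : Type u} [CommRing S] {E : Type (max u v)}
    [AddCommGroup E] [Module S E] (hE : Module.Injective S E) {n : Ideal S} (hn : n.IsMaximal)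
    {z : E} (hz : ∀ s ∈ n, s • z = 0) {J : Ideal S} {a : S} (haJ : a ∉ J)
    (ha : ∀ s ∈ n, s * a ∈ J) : ∃ e : E, (∀ s ∈ J, s • e = 0) ∧ a • e = z := by
  let f : (S ⧸ n) →ₗ[S] (S ⧸ J) :=
    Submodule.liftQ n (LinearMap.toSpanSingleton S (S ⧸ J) (Submodule.Quotient.mk a)) fun c hc => by
      rw [LinearMap.mem_ker, LinearMap.toSpanSingleton_apply, ← Submodule.Quotient.mk_smul,
        Submodule.Quotient.mk_eq_zero]
      exact ha c hc
  let g : (S ⧸ n) →ₗ[S] E := Submodule.liftQ n (LinearMap.toSpanSingleton S E z) hz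
  have hf : Function.Injective f := by
    rw [← LinearMap.ker_eq_bot, Submodule.ker_liftQ_eq_bot']
    refine hn.eq_of_le ?_ fun s hs => ?_
    · rw [Ideal.ne_top_iff_one, LinearMap.mem_ker, LinearMap.toSpanSingleton_apply, one_smul,
        Submodule.Quotient.mk_eq_zero]
      exact haJ
    · rw [LinearMap.mem_ker, LinearMap.toSpanSingleton_apply, ← Submodule.Quotient.mk_smul,
        Submodule.Quotient.mk_eq_zero]
      exact ha s hs
  obtain ⟨h, hh⟩ := (Module.Baer.of_injective hE).extension_property f hf g
  refine ⟨h (Submodule.Quotient.mk 1), fun s hs => ?_, ?_⟩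
  · rw [← map_smul, ← Submodule.Quotient.mk_smul, smul_eq_mul, mul_one,
      (Submodule.Quotient.mk_eq_zero J).2 hs, map_zero]
  · have h1 : f (Submodule.Quotient.mk 1) = a • (Submodule.Quotient.mk 1 : S ⧸ J) := by
      simp only [f, Submodule.liftQ_apply, LinearMap.toSpanSingleton_apply, one_smul]
      rw [← Submodule.Quotient.mk_smul, smul_eq_mul, mul_one]
    rw [← map_smul, ← h1, ← LinearMap.comp_apply, hh]
    change (1 : S) • z = z
    rw [one_smul]

/-- If the coefficients of every relation between the `g t` lie in `n`, then there is an ideal `J`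
modulo which all the `g t` become one nonzero element killed by `n`. -/
theorem exists_ideal_identifying {S : Type*} [CommRing S] (n : Ideal S) (hn : n ≠ ⊤) (g : ℕ → S)
    (hg : ∀ c : ℕ →₀ S, Finsupp.linearCombination S g c = 0 → ∀ t, c t ∈ n) :
    ∃ J : Ideal S, g 0 ∉ J ∧ (∀ s ∈ n, s * g 0 ∈ J) ∧ ∀ t, g 0 - g t ∈ J := by
  let σ : (ℕ →₀ S) →ₗ[S] S := Finsupp.linearCombination S fun _ => (1 : S)
  -- J consists of the combinations ∑ c_t g_t with ∑ c_t ∈ n. If g_0 were one of them, the relation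
  -- δ_0 - c would have coefficients in n, whose sum 1 - ∑ c_t would put 1 in n.
  refine ⟨(Submodule.comap σ n).map (Finsupp.linearCombination S g), ?_, ?_, ?_⟩
  · rintro ⟨c, hc, hcg⟩
    have h0 := hg (Finsupp.single 0 1 - c) (by rw [map_sub, hcg]; simp)
    have h1 : σ (Finsupp.single 0 1 - c) ∈ n := by
      rw [Finsupp.linearCombination_apply, Finsupp.sum]
      exact sum_mem fun t _ => by simpa using h0 t
    refine hn ((Ideal.eq_top_iff_one n).2 ?_)
    have h2 : (1 : S) = σ (Finsupp.single 0 1 - c) + σ c := by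
      rw [← map_add, sub_add_cancel]; simp [σ]
    rw [h2]
    exact add_mem h1 hc
  · intro s hs
    refine ⟨Finsupp.single 0 s, ?_, by simp⟩
    change σ _ ∈ n
    simpa [σ] using hs
  · intro t
    refine ⟨Finsupp.single 0 1 - Finsupp.single t 1, ?_, by simp⟩
    change σ _ ∈ n
    simp [σ]

/-- With `x`, `y` parameters, the elements `g t = x ^ t * y ^ (1 / p ^ t)` satisfy no relation with a
coefficient outside the maximal ideal. Identifying all the `g t` makes `g 0` a socle element lying in
every power of the maximal ideal, so an element of `E` on which `g 0` acts nontrivially is not killed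
by any such power. -/
theorem exists_forall_pow_smul_ne_zero {R : Type u} {K : Type w} [CommRing R] [IsDomain R]
    [IsNoetherianRing R] [Field K] (p : ℕ) [Fact p.Prime] [CharP R p] [CharP K p] (ε : R →+* K)
    (hε : Function.Surjective ε) (hht : 2 ≤ (RingHom.ker ε).height)
    {E : Type (max u v)} [AddCommGroup E] [Module (PerfectClosure R p) E]
    (ι : PerfectResidue p ε →ₗ[PerfectClosure R p] E) (hι : IsInjectiveHull ι) :
    ∃ e : E, ∀ t : ℕ, ∃ r ∈ RingHom.ker ε ^ t, PerfectClosure.of R p r • e ≠ 0 := by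
  have hp : p.Prime := Fact.out
  have := RingHom.ker_isPrime ε
  obtain ⟨x, y, P, Q, hPp, hQp, hP, hPm, hQP, hy, hyQ, hxQ⟩ :=
    exists_parameters_of_two_le_height (RingHom.ker ε) hht
  let φ := perfectClosureMap p ε
  have hn : (RingHom.ker φ).IsMaximal :=
    RingHom.ker_isMaximal_of_surjective φ (perfectClosureMap_surjective p hε)
  let X := PerfectClosure.of R p x
  let Y : ℕ → PerfectClosure R p := fun t => PerfectClosure.mk R p (t, y)
  have hY : ∀ t, Y t ^ p ^ t = PerfectClosure.of R p y := fun t => PerfectClosure.mk_pow_pow p t y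
  have hYlt : ∀ s t, s < t → Y t ^ p ∣ Y s := by
    intro s t hst
    obtain ⟨d, rfl⟩ := Nat.exists_eq_add_of_lt hst
    have : Y s = Y (s + d + 1) ^ p ^ (d + 1) := by
      refine (bijective_iterateFrobenius (PerfectClosure R p) p s).1 ?_
      simp only [iterateFrobenius_def]
      rw [hY, ← pow_mul, ← pow_add, ← hY (s + d + 1)]
      ring_nf
    rw [this]
    exact pow_dvd_pow _ (Nat.le_self_pow (by omega) p)
  obtain ⟨J, hJ0, hJn, hJt⟩ := exists_ideal_identifying (RingHom.ker φ) hn.ne_top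
    (fun t => X ^ t * Y t) fun c hc t => by
      by_contra hct
      -- The terms with s < t are multiples of y_t^p because y_s = y_t^(p^(t-s)); those with s > t
      -- are multiples of x^(t+1).
      have hmem : c t * (X ^ t * Y t) ∈ Ideal.span {X ^ (t + 1), Y t ^ p} := by
        have : c t * (X ^ t * Y t) = -∑ s ∈ c.support.erase t, c s * (X ^ s * Y s) := by
          rw [Finsupp.linearCombination_apply, Finsupp.sum] at hc
          rw [eq_neg_iff_add_eq_zero, ← hc]
          exact Finset.add_sum_erase c.support (fun s => c s * (X ^ s * Y s))
            (Finsupp.mem_support_iff.2 fun h => hct (by rw [h]; exact zero_mem _))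
        rw [this]
        refine neg_mem (sum_mem fun s hs => Ideal.mul_mem_left _ _ ?_)
        rcases lt_or_gt_of_ne (Finset.ne_of_mem_erase hs) with h | h
        · exact Ideal.mul_mem_left _ _ (Ideal.mem_of_dvd _ (hYlt s t h)
            (Ideal.subset_span (by simp)))
        · exact Ideal.mul_mem_right _ _ (Ideal.mem_of_dvd _ (pow_dvd_pow X h)
            (Ideal.subset_span (by simp)))
      obtain ⟨α, β, hαβ⟩ := Ideal.mem_span_pair.1 hmem
      obtain ⟨e₁, h₁⟩ := PerfectClosure.eventually_pow_mem_range p α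
      obtain ⟨e₂, h₂⟩ := PerfectClosure.eventually_pow_mem_range p β
      obtain ⟨e₃, h₃⟩ := PerfectClosure.eventually_pow_mem_range p (c t)
      -- The p^(t+e)-th power turns y_t into y^(p^e) and x^t into (x^(p^t))^(t p^e), whence N = p^t.
      -- Large e brings all coefficients into R.
      obtain ⟨e, he, hne⟩ := exists_mul_monomial_notMem hP hQP hy hyQ hxQ hp.two_le
        (pow_ne_zero t hp.ne_zero) t (e₁ + e₂ + e₃)
      obtain ⟨α', hα⟩ := h₁ (t + e) (by omega)
      obtain ⟨β', hβ⟩ := h₂ (t + e) (by omega)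
      obtain ⟨d, hd⟩ := h₃ (t + e) (by omega)
      refine hne d (fun hdP => hct ?_) (Ideal.mem_span_pair.2 ⟨α', β', ?_⟩)
      · have : φ (c t) ^ p ^ (t + e) = 0 := by
          rw [← map_pow, hd, perfectClosureMap_of, (RingHom.mem_ker).1 (hPm hdP), map_zero]
        exact (RingHom.mem_ker).2 (pow_eq_zero_iff (pow_ne_zero _ hp.ne_zero) |>.1 this)
      · apply PerfectClosure.of_injective p
        have h := congrArg (· ^ p ^ (t + e)) hαβ
        simp only [add_pow_char_pow, mul_pow, hα, hβ, hd] at h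
        have hYe : Y t ^ p ^ (t + e) = PerfectClosure.of R p y ^ p ^ e := by
          rw [pow_add, pow_mul, hY]
        rw [← pow_mul (Y t), mul_comm p, pow_mul (Y t), hYe] at h
        simp only [map_add, map_mul, map_pow]
        simp only [X] at h
        linear_combination h
  have hz : ∀ s ∈ RingHom.ker φ,
      s • ι (show PerfectResidue p ε from (1 : PerfectClosure K p)) = 0 := by
    intro s hs
    have h1 : s • (show PerfectResidue p ε from (1 : PerfectClosure K p)) = 0 :=
      (mul_one (φ s)).trans hs
    rw [← map_smul, h1, map_zero]
  obtain ⟨e, heJ, he⟩ := Module.Injective.exists_smul_eq hι.injective_module hn hz hJ0 hJn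
  refine ⟨e, fun t => ?_⟩
  by_contra! hcon
  have hxm : x ∈ RingHom.ker ε := hPm (hP.1.2 (Ideal.subset_span (by simp)))
  have h0 : (X ^ 0 * Y 0) • e = 0 := by
    have : X ^ 0 * Y 0 = (X ^ 0 * Y 0 - X ^ t * Y t) + Y t * PerfectClosure.of R p (x ^ t) := by
      rw [map_pow]; ring
    rw [this, add_smul, heJ _ (hJt t), mul_smul, hcon _ (Ideal.pow_mem_pow hxm t), smul_zero,
      add_zero]
  rw [h0] at he
  have h1 : (1 : PerfectClosure K p) = 0 :=
    hι.injective_map (a₁ := (1 : PerfectClosure K p)) (a₂ := 0) (by rw [← he, map_zero])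
  exact one_ne_zero h1

/-! ### Dimension and height in standard graded algebras. -/

/-- Incomparability alone gives this: contraction of primes is strictly monotone, even when A → B is
not injective. -/
theorem ringKrullDim_le_of_isIntegral (A B : Type*) [CommRing A] [CommRing B] [Algebra A B]
    [Algebra.IsIntegral A B] : ringKrullDim B ≤ ringKrullDim A :=
  Order.krullDim_le_of_strictMono (PrimeSpectrum.comap (algebraMap A B)) fun P Q hPQ =>
    Ideal.IsIntegral.comap_lt_comap (R := A) (I := P.asIdeal) (J := Q.asIdeal) hPQ

section Graded

variable {K : Type w} {R : Type u} [Field K] [CommRing R] [Algebra K R]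
  {𝒜 : ℕ → Submodule K R} [GradedAlgebra 𝒜]

theorem IsStandardGraded.ker_augmentation (h : IsStandardGraded 𝒜) :
    RingHom.ker h.augmentation = (HomogeneousIdeal.irrelevant 𝒜).toIdeal := by
  ext r
  rw [RingHom.mem_ker, HomogeneousIdeal.mem_iff, HomogeneousIdeal.mem_irrelevant_iff]
  simp only [IsStandardGraded.augmentation, RingHom.comp_apply, RingHom.coe_coe,
    EmbeddingLike.map_eq_zero_iff]
  rw [← Subtype.coe_inj]
  rfl

theorem IsStandardGraded.augmentation_surjective (h : IsStandardGraded 𝒜) :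
    Function.Surjective h.augmentation := by
  intro k
  refine ⟨algebraMap K R k, ?_⟩
  simp only [IsStandardGraded.augmentation, RingHom.comp_apply, RingHom.coe_coe]
  rw [RingEquiv.symm_apply_eq]
  ext
  exact DirectSum.decompose_of_mem_same 𝒜 (SetLike.algebraMap_mem_graded 𝒜 k)

theorem IsStandardGraded.isNoetherianRing (h : IsStandardGraded 𝒜) : IsNoetherianRing R := by
  obtain ⟨s, -, hs⟩ := h.generated
  have : Algebra.FiniteType K R := ⟨⟨s, hs⟩⟩
  exact Algebra.FiniteType.isNoetherianRing K R

theorem span_pow_le_graded {s : Set R} (hs : s ⊆ 𝒜 1) (n : ℕ) : Submodule.span K s ^ n ≤ 𝒜 n := by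
  induction n with
  | zero =>
    rw [pow_zero, Submodule.one_le]
    exact SetLike.GradedOne.one_mem
  | succ n ih =>
    rw [pow_succ, Submodule.mul_le]
    exact fun a ha b hb => SetLike.GradedMul.mul_mem (ih ha) (Submodule.span_le.2 hs hb)

theorem iSup_span_pow_eq_top {s : Set R} (hs : Algebra.adjoin K s = ⊤) :
    ⨆ n : ℕ, Submodule.span K s ^ n = ⊤ := by
  rw [eq_top_iff]
  rintro r -
  have hr : r ∈ Algebra.adjoin K s := hs ▸ Algebra.mem_top
  induction hr using Algebra.adjoin_induction with
  | mem x hx =>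
    exact Submodule.mem_iSup_of_mem 1 (by rw [pow_one]; exact Submodule.subset_span hx)
  | algebraMap k =>
    exact Submodule.mem_iSup_of_mem 0 (by rw [pow_zero]; exact Submodule.algebraMap_mem k)
  | add x y _ _ hx hy => exact add_mem hx hy
  | mul x y _ _ hx hy =>
    have h := Submodule.mul_mem_mul hx hy
    rw [Submodule.iSup_mul] at h
    refine (iSup_le fun i => ?_ : _ ≤ ⨆ n : ℕ, Submodule.span K s ^ n) h
    rw [Submodule.mul_iSup]
    refine iSup_le fun j => ?_
    rw [← pow_add]
    exact le_iSup (fun n : ℕ => Submodule.span K s ^ n) (i + j)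

theorem graded_eq_span_pow {s : Set R} (hs : s ⊆ 𝒜 1) (hgen : Algebra.adjoin K s = ⊤) (n : ℕ) :
    𝒜 n = Submodule.span K s ^ n := by
  refine le_antisymm (fun a ha => ?_) (span_pow_le_graded hs n)
  have key : ∀ r : R, (DirectSum.decompose 𝒜 r n : R) ∈ Submodule.span K s ^ n := by
    intro r
    have hr : r ∈ ⨆ n : ℕ, Submodule.span K s ^ n := iSup_span_pow_eq_top hgen ▸ Submodule.mem_top
    induction hr using Submodule.iSup_induction' with
    | mem i x hx =>
      by_cases hin : i = n
      · subst hin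
        rwa [DirectSum.decompose_of_mem_same 𝒜 (span_pow_le_graded hs i hx)]
      · rw [DirectSum.decompose_of_mem_ne 𝒜 (span_pow_le_graded hs i hx) hin]
        exact zero_mem _
    | zero => simp
    | add x y _ _ hx hy =>
      rw [DirectSum.decompose_add, DirectSum.add_apply, Submodule.coe_add]
      exact add_mem hx hy
  simpa [DirectSum.decompose_of_mem_same 𝒜 ha] using key a

/-- A standard graded algebra with a homogeneous element `f` of positive degree generating, up to
radical, the irrelevant ideal has dimension at most one. -/
theorem IsStandardGraded.ringKrullDim_le_one (h : IsStandardGraded 𝒜) {f : R} {d : ℕ}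
    (hd : 0 < d) (hf : f ∈ 𝒜 d)
    (hrad : (HomogeneousIdeal.irrelevant 𝒜).toIdeal ≤ (Ideal.span {f}).radical) :
    ringKrullDim R ≤ 1 := by
  classical
  have := h.isNoetherianRing
  obtain ⟨s, hs, hgen⟩ := h.generated
  obtain ⟨N, hN⟩ := Ideal.exists_pow_le_of_le_radical_of_fg hrad (IsNoetherian.noetherian _)
  have hirr : ∀ n, ∀ b ∈ 𝒜 n, b ∈ (HomogeneousIdeal.irrelevant 𝒜).toIdeal ^ n := by
    intro n
    induction n with
    | zero => simp
    | succ n ih =>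
      rw [graded_eq_span_pow hs hgen, pow_succ, ← graded_eq_span_pow hs hgen]
      intro b hb
      induction hb using Submodule.mul_induction_on' with
      | mem_mul_mem a ha c hc =>
        rw [pow_succ]
        exact Ideal.mul_mem_mul (ih a ha)
          (HomogeneousIdeal.mem_irrelevant_of_mem 𝒜 zero_lt_one (Submodule.span_le.2 hs hc))
      | add a _ c _ ha hc => exact add_mem ha hc
  -- R is shown to be finite over K[X], with X acting as f, generated by the pieces of degree less
  -- than N.
  let _ : Algebra (Polynomial K) R := (Polynomial.aeval f).toAlgebra
  have hX : ∀ r : R, (Polynomial.X : Polynomial K) • r = f * r := fun r => by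
    rw [Algebra.smul_def]
    exact congrArg (· * r) (Polynomial.aeval_X f)
  have hC : ∀ (k : K) (r : R), (Polynomial.C k) • r = k • r := fun k r => by
    rw [Algebra.smul_def, Algebra.smul_def]
    exact congrArg (· * r) (Polynomial.aeval_C f k)
  have hfg : ∀ n : ℕ, ∃ w : Finset R, Submodule.span K (w : Set R) = 𝒜 n := fun n => by
    rw [graded_eq_span_pow hs hgen]
    exact (Submodule.FG.pow ⟨s, rfl⟩ n)
  choose w hw using hfg
  let M : Submodule (Polynomial K) R :=
    Submodule.span (Polynomial K) (((Finset.range N).biUnion w : Finset R) : Set R)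
  have hM : ∀ n, ∀ b ∈ 𝒜 n, b ∈ M := by
    intro n
    induction n using Nat.strong_induction_on with
    | _ n ih =>
      intro b hb
      by_cases hn : n < N
      · rw [← hw n] at hb
        induction hb using Submodule.span_induction with
        | mem x hx =>
          exact Submodule.subset_span (Finset.mem_biUnion.2 ⟨n, Finset.mem_range.2 hn, hx⟩)
        | zero => exact zero_mem _
        | add x y _ _ hx hy => exact add_mem hx hy
        | smul k x _ hx =>
          rw [← hC]
          exact M.smul_mem _ hx
      -- In degree n ≥ N every element is f c, and c may be replaced by its component of degree n -
      -- d; if d > n the element is zero.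
      · obtain ⟨c, rfl⟩ := Ideal.mem_span_singleton.1
          (hN (Ideal.pow_le_pow_right (not_lt.1 hn) (hirr n b hb)))
        have hcomp : f * c = if d ≤ n then f * (DirectSum.decompose 𝒜 c (n - d) : R) else 0 := by
          rw [← DirectSum.coe_decompose_mul_of_left_mem 𝒜 n hf]
          exact (DirectSum.decompose_of_mem_same 𝒜 hb).symm
        rw [hcomp]
        split_ifs with hdn
        · rw [← hX]
          exact M.smul_mem _ (ih (n - d) (by omega) _ (SetLike.coe_mem _))
        · exact zero_mem _
  have hfin : Module.Finite (Polynomial K) R := by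
    refine ⟨⟨(Finset.range N).biUnion w, eq_top_iff.2 fun r _ => ?_⟩⟩
    rw [← DirectSum.sum_support_decompose 𝒜 r]
    exact sum_mem fun i _ => hM i _ (SetLike.coe_mem _)
  refine (ringKrullDim_le_of_isIntegral (Polynomial K) R).trans ?_
  rw [Polynomial.ringKrullDim_of_isNoetherianRing, ringKrullDim_eq_zero_of_field, zero_add]

theorem IsStandardGraded.homogeneous_le_irrelevant (h : IsStandardGraded 𝒜) {Q : Ideal R}
    (hQ : Q ≠ ⊤) (hQh : Q.IsHomogeneous 𝒜) : Q ≤ (HomogeneousIdeal.irrelevant 𝒜).toIdeal := by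
  intro q hq
  rw [HomogeneousIdeal.mem_iff, HomogeneousIdeal.mem_irrelevant_iff]
  by_contra hne
  obtain ⟨k, hk⟩ := h.bijective_zero.2 (DirectSum.decompose 𝒜 q 0)
  have hk' : algebraMap K R k = GradedRing.proj 𝒜 0 q := congrArg Subtype.val hk
  have hk0 : k ≠ 0 := by
    rintro rfl
    rw [map_zero] at hk'
    exact hne hk'.symm
  refine hQ (Ideal.eq_top_of_isUnit_mem Q (hQh 0 hq) ?_)
  rw [← GradedRing.proj_apply, ← hk']
  exact (IsUnit.mk0 k hk0).map (algebraMap K R)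

/-- Take a nonzero homogeneous f of positive degree. If the irrelevant ideal had height less than 2,
it would be contained in every minimal prime of (f), hence in the radical of (f), forcing dimension
at most 1. -/
theorem IsStandardGraded.two_le_height [IsDomain R] (h : IsStandardGraded 𝒜)
    (hdim : 2 ≤ ringKrullDim R) : 2 ≤ (RingHom.ker h.augmentation).height := by
  classical
  have := h.isNoetherianRing
  have hmax := RingHom.ker_isMaximal_of_surjective _ h.augmentation_surjective
  have hker := h.ker_augmentation
  by_contra! hlt
  have hbot : RingHom.ker h.augmentation ≠ ⊥ := by
    intro hbot
    rw [hbot] at hmax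
    have := ringKrullDim_eq_zero_of_isField (Ring.isField_iff_maximal_bot.2 hmax)
    rw [this] at hdim
    exact absurd hdim (by decide)
  obtain ⟨a, ha, ha0⟩ := Submodule.exists_mem_ne_zero_of_ne_bot hbot
  obtain ⟨d, hd⟩ : ∃ d, (DirectSum.decompose 𝒜 a d : R) ≠ 0 := by
    by_contra! hcon
    refine ha0 ?_
    rw [← DirectSum.sum_support_decompose 𝒜 a]
    exact Finset.sum_eq_zero fun i _ => hcon i
  set f : R := (DirectSum.decompose 𝒜 a d : R)
  have hf : f ∈ 𝒜 d := SetLike.coe_mem _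
  have hd0 : 0 < d := by
    rw [Nat.pos_iff_ne_zero]
    rintro rfl
    rw [hker, HomogeneousIdeal.mem_iff, HomogeneousIdeal.mem_irrelevant_iff] at ha
    exact hd ha
  have hle := h.ringKrullDim_le_one hd0 hf (by
    rw [← Ideal.sInf_minimalPrimes]
    refine le_sInf fun Q hQ => ?_
    have hQp := hQ.1.1
    have hfQ : f ∈ Q := hQ.1.2 (Ideal.mem_span_singleton_self f)
    -- The homogeneous core of Q is a prime containing f, so minimality makes Q homogeneous.
    have hcore : Q ≤ (Q.homogeneousCore 𝒜).toIdeal :=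
      hQ.2 ⟨hQp.homogeneousCore, by
        rw [Ideal.span_singleton_le_iff_mem]
        exact Ideal.mem_homogeneousCore_of_homogeneous_of_mem ⟨d, hf⟩ hfQ⟩
        (Ideal.toIdeal_homogeneousCore_le 𝒜 Q)
    have hQh : Q.IsHomogeneous 𝒜 := by
      rw [Ideal.IsHomogeneous.iff_eq]
      exact le_antisymm (Ideal.toIdeal_homogeneousCore_le 𝒜 Q) hcore
    have hQm := h.homogeneous_le_irrelevant hQp.ne_top hQh
    rw [← hker] at hQm ⊢
    by_contra hnle
    have hQlt : Q < RingHom.ker h.augmentation := lt_of_le_not_ge hQm hnle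
    have hQ0 : ⊥ < Q := bot_lt_iff_ne_bot.2 fun hb => hd (by rw [hb] at hfQ; exact hfQ)
    have h1 := Ideal.height_add_one_le_of_lt_of_isPrime hQ0
    have h2 := Ideal.height_add_one_le_of_lt_of_isPrime hQlt
    refine hlt.not_ge (le_trans ?_ h2)
    refine le_trans ?_ (add_le_add_left h1 1)
    rw [Ideal.height_bot]
    norm_num)
  exact absurd (hdim.trans hle) (by decide)

end Graded

theorem theorem5p8 (p : ℕ) [Fact p.Prime] :
    -- complete local domains
    (∀ (R : Type u) [CommRing R] [IsDomain R] [IsNoetherianRing R] [IsLocalRing R]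
        [IsAdicComplete (IsLocalRing.maximalIdeal R) R] [CharP R p],
      2 ≤ ringKrullDim R →
      ∀ (E : Type (max u v)) [AddCommGroup E] [Module (PerfectClosure R p) E]
        (ι : PerfectResidue p (IsLocalRing.residue R) →ₗ[PerfectClosure R p] E),
        IsInjectiveHull ι →
        ∃ e : E, ∀ t : ℕ, ∃ r ∈ IsLocalRing.maximalIdeal R ^ t,
          PerfectClosure.of R p r • e ≠ 0) ∧
    -- standard graded domains
    (∀ (K : Type w) (R : Type u) [Field K] [CharP K p] [CommRing R] [IsDomain R] [CharP R p]
        [Algebra K R] (𝒜 : ℕ → Submodule K R) [GradedAlgebra 𝒜] (h𝒜 : IsStandardGraded 𝒜),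
      2 ≤ ringKrullDim R →
      ∀ (E : Type (max u v)) [AddCommGroup E] [Module (PerfectClosure R p) E]
        (ι : PerfectResidue p h𝒜.augmentation →ₗ[PerfectClosure R p] E),
        IsInjectiveHull ι →
        ∃ e : E, ∀ t : ℕ, ∃ r ∈ (HomogeneousIdeal.irrelevant 𝒜).toIdeal ^ t,
          PerfectClosure.of R p r • e ≠ 0) := by
  refine ⟨?_, ?_⟩
  · intro R _ _ _ _ _ _ hdim E _ _ ι hι
    have hker : RingHom.ker (IsLocalRing.residue R) = IsLocalRing.maximalIdeal R :=
      IsLocalRing.ker_residue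
    have hht : 2 ≤ (RingHom.ker (IsLocalRing.residue R)).height := by
      rw [hker]
      rw [← IsLocalRing.maximalIdeal_height_eq_ringKrullDim] at hdim
      exact WithBot.coe_le_coe.1 hdim
    rw [← hker]
    exact exists_forall_pow_smul_ne_zero.{u, v, u} p _ IsLocalRing.residue_surjective hht ι hι
  · intro K R _ _ _ _ _ _ 𝒜 _ h𝒜 hdim E _ _ ι hι
    have := h𝒜.isNoetherianRing
    rw [← h𝒜.ker_augmentation]
    exact exists_forall_pow_smul_ne_zero.{u, v, w} p _ h𝒜.augmentation_surjective
      (h𝒜.two_le_height hdim) ι hι
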